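/- **Theorem 4.2 (Drazin inverse solution of $XA=B$).** Let $\mathbb H$ be the real quaternions, $A\in\mathbb H^{n\times n}$ Hermitian ($A^*=A$) and $B\in\mathbb H^{m\times n}$. Write $\operatorname{rank}$ for the maximal number of left-linearly independent rows (equivalently, of right-linearly independent columns). Let $k=\operatorname{Ind}A$ be the least $k\ge 0$ with $\operatorname{rank}A^{k+1}=\operatorname{rank}A^{k}$, and let $r=\operatorname{rank}A^{k+1}=\operatorname{rank}A^{k}\le n$. The Drazin inverse $A^D$ is the unique matrix $X$ with $A^{k+1}X=A^k$, $XAX=X$ and $AX=XA$; it exists. For a finite set $\alpha$ of positive integers, a quaternion matrix $C=(c_{pq})$ with rows and columns indexed by $\alpha$, and $j\in\alpha$, the $j$-th row determinant is $$\operatorname{rdet}_j C=\sum_{\sigma}(-1)^{|\alpha|-s}\,\bigl(c_{j\,\sigma(j)}\,c_{\sigma(j)\,\sigma^2(j)}\cdots c_{\sigma^{l_1}(j)\,j}\bigr)\bigl(c_{i_2\,\sigma(i_2)}\cdots c_{\sigma^{l_2}(i_2)\,i_2}\bigr)\cdots\bigl(c_{i_s\,\sigma(i_s)}\cdots c_{\sigma^{l_s}(i_s)\,i_s}\bigr),$$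 where $\sigma$ runs over the permutations of $\alpha$, $s$ is the number of cycles of $\sigma$ (fixed points included), the first cycle contains $j$ and is opened by $j$, each other cycle is opened by its least element $i_t$, $l_t+1$ is the length of the $t$-th cycle, and $i_2<i_3<\dots<i_s$. For Hermitian $C$ all $\operatorname{rdet}_jC$ are equal, and $|C|$ denotes their common value (with $|C|=1$ for the empty matrix). For an $n\times n$ matrix $C$ and $\alpha\subseteq\{1,\dots,n\}$, $C_\alpha^\alpha$ is the principal submatrix with rows and columns indexed by $\alpha$, and $C_{j.}(b)$ is $C$ with its $j$-th row replaced by the row $b$. Put $I_{r,n}=\{\alpha\subseteq\{1,\dots,n\}:|\alpha|=r\}$ and $I_{r,n}\{j\}=\{\alpha\in I_{r,n}: j\in\alpha\}$. Let $\check b_{i.}$ be the $i$-th row of $\check B=BA^k$. Then $\sum_{\alpha\in I_{r,n}}\bigl|(A^{k+1})_\alpha^\alpha\bigr|$ is a nonzero real number, and the Drazin inverse solution $X=BA^D=(x_{ij})$ of $XA=B$ satisfies, for all $i=1,\dots,m$ and $j=1,\dots,n$, $$x_{ij}=\frac{\displaystyle\sum_{\alpha\in I_{r,n}\{j\}}\operatorname{rdet}_j\Bigl(\bigl((A^{k+1})_{j.}(\check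 b_{i.})\bigr)_\alpha^\alpha\Bigr)}{\displaystyle\sum_{\alpha\in I_{r,n}}\bigl|(A^{k+1})_\alpha^\alpha\bigr|}.$$ -/

import Mathlib

open scoped Quaternion

noncomputable section

namespace QuaternionMatrix

section RowDeterminant

variable {ι R : Type*} [Fintype ι] [LinearOrder ι] [Ring R]

/-- The ordered product `a_{i, σ i} a_{σ i, σ² i} ⋯ a_{σ^l i, i}` of the entries of `A` along the
cycle of `σ` through `i` (a fixed point `i` gives `a_{i i}`), the factor from row `i` first. -/
def cycleProd (A : Matrix ι ι R) (σ : Equiv.Perm ι) (i : ι) : R :=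
  ((List.range (Function.minimalPeriod σ i)).map
    fun s => A ((σ ^ s) i) ((σ ^ (s + 1)) i)).prod

open scoped Classical in
/-- The least elements of the cycles of `σ` (fixed points included) that do not contain `i`. -/
def otherLeaders (σ : Equiv.Perm ι) (i : ι) : Finset ι :=
  Finset.univ.filter fun x => ¬ σ.SameCycle i x ∧ ∀ y, σ.SameCycle x y → x ≤ y

/-- The `i`-th row determinant. For each `σ`, the cycle through `i` comes first and is opened by
`i`; the other cycles are opened by their least elements and follow in increasing order of
these. The sign `(-1)^(n - r)`, `r` the number of cycles of `σ` (fixed points included), is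
the signature of `σ`. -/
def rdet (i : ι) (A : Matrix ι ι R) : R :=
  ∑ σ : Equiv.Perm ι, (Equiv.Perm.sign σ : ℤ) •
    (cycleProd A σ i *
      (((otherLeaders σ i).sort (· ≤ ·)).map fun x => cycleProd A σ x).prod)

open scoped Classical in
/-- The determinant of a Hermitian matrix. All its row determinants are equal; we take the one
at the least index. The determinant of the empty matrix is `1`. -/
def hermDet (A : Matrix ι ι R) : R :=
  if h : (Finset.univ : Finset ι).Nonempty then rdet (Finset.univ.min' h) A else 1

end RowDeterminant

/-- The principal submatrix with rows and columns indexed by `α`. -/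
def principal {n : ℕ} (A : Matrix (Fin n) (Fin n) ℍ[ℝ]) (α : Finset (Fin n)) :
    Matrix {x // x ∈ α} {x // x ∈ α} ℍ[ℝ] :=
  A.submatrix Subtype.val Subtype.val

/-- The sum of all principal minors of order `r` of a Hermitian matrix. -/
def sumPrincipalMinors {n : ℕ} (r : ℕ) (A : Matrix (Fin n) (Fin n) ℍ[ℝ]) : ℍ[ℝ] :=
  ∑ α : {α : Finset (Fin n) // α.card = r}, hermDet (principal A α.1)

/-- The sum, over the index sets `α` of size `r` that contain `j`, of the `j`-th row determinants
of the principal submatrices of `A` indexed by `α`. -/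
def sumRdet {n : ℕ} (r : ℕ) (j : Fin n) (A : Matrix (Fin n) (Fin n) ℍ[ℝ]) : ℍ[ℝ] :=
  ∑ α : {α : Finset (Fin n) // α.card = r ∧ j ∈ α}, rdet ⟨j, α.2.2⟩ (principal A α.1)

/-- The rank of a quaternion matrix: the maximal number of left-linearly independent rows, which
is also the maximal number of right-linearly independent columns. -/
def qrank {m n : ℕ} (A : Matrix (Fin m) (Fin n) ℍ[ℝ]) : ℕ :=
  Module.finrank ℍ[ℝ] (Submodule.span ℍ[ℝ] (Set.range A.row))

/-- The index of a square matrix: the least `k ≥ 0` with `rank A^(k+1) = rank A^k`. Such a `k`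
always exists because the ranks of the powers decrease. -/
def index {n : ℕ} (A : Matrix (Fin n) (Fin n) ℍ[ℝ]) : ℕ :=
  sInf {k | qrank (A ^ (k + 1)) = qrank (A ^ k)}

/-- `X` satisfies the three equations that characterize the Drazin inverse of `A`. -/
structure IsDrazinInverse {n : ℕ} (A X : Matrix (Fin n) (Fin n) ℍ[ℝ]) : Prop where
  pow_mul : A ^ (index A + 1) * X = A ^ index A
  mul_mul : X * A * X = X
  comm : A * X = X * A

open scoped Classical in
/-- The Drazin inverse `A^D`. -/
def drazinInverse {n : ℕ} (A : Matrix (Fin n) (Fin n) ℍ[ℝ]) : Matrix (Fin n) (Fin n) ℍ[ℝ] :=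
  if h : ∃ X, IsDrazinInverse A X then h.choose else 0

end QuaternionMatrix

end

/-!
The proof reduces the determinantal formula to a matrix identity of Faddeev-LeVerrier type for a
Hermitian quaternion matrix `H`, applied to `H = A ^ (k + 1)`.

*Expansion along a row.* Grouping the permutations `σ` in `rdet j` by `l = σ j` and contracting `l`
into `j` gives, without any symmetry of `H`, `rowMinor_insert`: the `j`-th row determinant
with `j`-th row `b` is `b_j` times the complementary minor minus the sum of the `b_l` times the row
determinants of order one less whose `j`-th row is the `l`-th row of `H`. The leading-element
convention for cycles matters only here.

*Hermitian matrices.* Iterating the expansion writes the row determinants as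
`q_{aj} ⋆ D`, where `D` is the function assigning to an index set its principal minor, `q_{aj}` is
the signed sum over self-avoiding paths from `a` to `j` (`pathSum`), and `⋆` is the convolution over
disjoint unions (`disjConv`). Reversing a path conjugates `q`, so that closed paths have central
sums; splitting a path at an interior point gives `disjConv_pathSum_insert`. From these two facts
it follows that the minors are real, that they can be expanded along any row
(`IsMinorFunction.expand_insert`), and that a row determinant with two equal rows vanishes
(`IsMinorFunction.disjConv_eq_zero_of_mem_left`).

*Sums of adjugates.* Let `e_s` be the sum of the principal minors of order `s` and put `Q_0 = 0`,
`Q_{s+1} = e_s - H Q_s`. Summing the expansions over all index sets of size `s` gives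
`sumRdet_updateRow`: the numerator in the theorem is the `j`-th entry of `b Q_s`. Moreover
`tr (H Q_s) = s e_s`, and `Q_s = 0` for `s = n + 2`.

*Rank.* If `s` is the last order with `e_s ≠ 0`, then `H ^ p Q_{s+1} = 0` for some `p`, so that
`H Q_{s+1} = 0` because `H` is Hermitian. Hence `P = e_s⁻¹ H Q_s` is an idempotent with the row
space of `H`, and comparing its trace with its rank gives `s = rank H` (`minorSum_qrank`). With
`r = rank H` it follows that `A ^ k H Q_r = e_r A ^ k`, and `e_r⁻¹ A ^ k Q_r` satisfies the
equations of the Drazin inverse (`isDrazinInverse_smul_adjugateSum`).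
-/

/-! ### Expansion of a row determinant by contracting an index -/

namespace QuaternionMatrix

section Orbits

variable {ι κ : Type*} [LinearOrder ι] [LinearOrder κ]

/-- If `e` carries the `τ`-orbit of `x` onto the `σ`-orbit of `e x`, the two cycles have equal
length. -/
lemma minimalPeriod_eq_of_orbit {e : κ ↪o ι} {σ : Equiv.Perm ι} {τ : Equiv.Perm κ} {x : κ}
    (h : ∀ s : ℕ, (σ ^ s) (e x) = e ((τ ^ s) x)) :
    Function.minimalPeriod σ (e x) = Function.minimalPeriod τ x := by
  rw [Function.minimalPeriod_eq_minimalPeriod_iff]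
  intro n
  simp only [Function.IsPeriodicPt, Function.IsFixedPt, Equiv.Perm.iterate_eq_pow, h,
    e.injective.eq_iff]

/-- `σ` on `ι` arises from `τ` on `κ ≃ {l}ᶜ` by inserting the point `l` into the cycle of `τ`
through `j`, immediately after `j`. -/
structure IsInsertion (e : κ ↪o ι) (j : κ) (l : ι) (σ : Equiv.Perm ι) (τ : Equiv.Perm κ) :
    Prop where
  apply_base : σ (e j) = l
  apply_new : σ l = e (τ j)
  apply_of_ne : ∀ x, x ≠ j → σ (e x) = e (τ x)

variable {e : κ ↪o ι} {j : κ} {l : ι} {σ : Equiv.Perm ι} {τ : Equiv.Perm κ}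

lemma IsInsertion.pow_apply (h : IsInsertion e j l σ τ) {x : κ} (hx : ¬ τ.SameCycle j x) (s : ℕ) :
    (σ ^ s) (e x) = e ((τ ^ s) x) := by
  induction s with
  | zero => rfl
  | succ s ih =>
    rw [pow_succ', pow_succ', Equiv.Perm.mul_apply, Equiv.Perm.mul_apply, ih, h.apply_of_ne]
    rintro rfl
    exact hx (Equiv.Perm.sameCycle_pow_left.2 (Equiv.Perm.SameCycle.refl _ _))

/-- The cycle of `σ` through `j` runs through `j`, `l`, and then along the cycle of `τ`. -/
lemma IsInsertion.pow_apply_base (h : IsInsertion e j l σ τ) {s : ℕ}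
    (hs : s < Function.minimalPeriod τ j) :
    (σ ^ (s + 2)) (e j) = e ((τ ^ (s + 1)) j) := by
  induction s with
  | zero => simp [pow_succ, Equiv.Perm.mul_apply, h.apply_base, h.apply_new]
  | succ s ih =>
    rw [pow_succ', Equiv.Perm.mul_apply, ih (by omega), h.apply_of_ne, pow_succ' τ (s + 1),
      Equiv.Perm.mul_apply]
    intro h0
    exact Function.not_isPeriodicPt_of_pos_of_lt_minimalPeriod (f := τ) (x := j)
      (Nat.succ_ne_zero s) hs (by
        simpa only [Function.IsPeriodicPt, Function.IsFixedPt, Equiv.Perm.iterate_eq_pow] using h0)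

lemma IsInsertion.minimalPeriod_base [Finite ι] [Finite κ] (h : IsInsertion e j l σ τ)
    (hl : ∀ x, e x ≠ l) :
    Function.minimalPeriod σ (e j) = Function.minimalPeriod τ j + 1 := by
  have hτ : 0 < Function.minimalPeriod τ j :=
    Function.minimalPeriod_pos_of_mem_periodicPts (τ.injective.mem_periodicPts j)
  have hp : Function.IsPeriodicPt τ (Function.minimalPeriod τ j) j :=
    Function.isPeriodicPt_minimalPeriod τ j
  simp only [Function.IsPeriodicPt, Function.IsFixedPt, Equiv.Perm.iterate_eq_pow] at hp
  apply le_antisymm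
  · apply Function.IsPeriodicPt.minimalPeriod_le (Nat.succ_pos _)
    obtain ⟨p, hp'⟩ := Nat.exists_eq_succ_of_ne_zero hτ.ne'
    simp only [Function.IsPeriodicPt, Function.IsFixedPt, Equiv.Perm.iterate_eq_pow]
    have := h.pow_apply_base (s := p) (by omega)
    rw [hp'] at hp ⊢
    rw [this, hp]
  · by_contra hlt
    have hσ : 0 < Function.minimalPeriod σ (e j) :=
      Function.minimalPeriod_pos_of_mem_periodicPts (σ.injective.mem_periodicPts _)
    have hq : Function.IsPeriodicPt σ (Function.minimalPeriod σ (e j)) (e j) :=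
      Function.isPeriodicPt_minimalPeriod σ _
    simp only [Function.IsPeriodicPt, Function.IsFixedPt, Equiv.Perm.iterate_eq_pow] at hq
    obtain ⟨q, hq'⟩ := Nat.exists_eq_succ_of_ne_zero hσ.ne'
    rw [hq'] at hq
    rcases q with _ | q
    · rw [pow_one, h.apply_base] at hq
      exact hl _ hq.symm
    · rw [h.pow_apply_base (by omega), e.injective.eq_iff] at hq
      exact Function.not_isPeriodicPt_of_pos_of_lt_minimalPeriod (f := τ) (x := j)
        (Nat.succ_ne_zero q) (by omega) (by
        simpa only [Function.IsPeriodicPt, Function.IsFixedPt, Equiv.Perm.iterate_eq_pow] using hq)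

variable {R : Type*} [Ring R]

lemma cycleProd_eq_of_orbit {e : κ ↪o ι} {σ : Equiv.Perm ι} {τ : Equiv.Perm κ} {x : κ}
    {A : Matrix ι ι R} {A' : Matrix κ κ R}
    (h : ∀ s : ℕ, (σ ^ s) (e x) = e ((τ ^ s) x))
    (hA : ∀ (s : ℕ) (y : κ), A (e ((τ ^ s) x)) (e y) = A' ((τ ^ s) x) y) :
    cycleProd A σ (e x) = cycleProd A' τ x := by
  simp only [cycleProd, minimalPeriod_eq_of_orbit h, h, hA]

/-- The ordered product over the leaders is unchanged under transport along an order embedding. -/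
lemma prod_sort_map {e : κ ↪o ι} (s : Finset κ) (f : ι → R) (g : κ → R)
    (h : ∀ x ∈ s, f (e x) = g x) :
    ((((s.map e.toEmbedding).sort (· ≤ ·)).map f).prod) = ((s.sort (· ≤ ·)).map g).prod := by
  rw [← Finset.map_sort e.toEmbedding s (· ≤ ·) (· ≤ ·) (fun a _ b _ => e.le_iff_le.symm),
    List.map_map]
  congr 1
  refine List.map_congr_left fun x hx => ?_
  exact h x ((Finset.mem_sort _).1 hx)

end Orbits

section CycleTransport

variable {ι κ : Type*} [Fintype ι] [LinearOrder ι] [Fintype κ] [LinearOrder κ]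

open scoped Classical in
/-- The leaders of the cycles of `σ` off the cycle of `i` are transported from `κ` whenever `e`
carries the `τ`-orbits onto these cycles. -/
lemma otherLeaders_eq_map {e : κ ↪o ι} {σ : Equiv.Perm ι} {τ : Equiv.Perm κ} {i : ι}
    (hcover : ∀ z, ¬ σ.SameCycle i z → ∃ x, e x = z)
    (horb : ∀ x, ¬ σ.SameCycle i (e x) → ∀ s : ℕ, (σ ^ s) (e x) = e ((τ ^ s) x)) :
    otherLeaders σ i = (Finset.univ.filter fun x =>
      ¬ σ.SameCycle i (e x) ∧ ∀ y, τ.SameCycle x y → x ≤ y).map e.toEmbedding := by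
  ext z
  simp only [otherLeaders, Finset.mem_filter, Finset.mem_univ, true_and, Finset.mem_map]
  constructor
  · rintro ⟨h1, h2⟩
    obtain ⟨x, rfl⟩ := hcover z h1
    refine ⟨x, ⟨h1, fun y hy => ?_⟩, rfl⟩
    obtain ⟨s, rfl⟩ := hy.exists_nat_pow_eq
    rw [← e.le_iff_le, ← horb x h1 s]
    exact h2 _ (Equiv.Perm.sameCycle_pow_right.2 (Equiv.Perm.SameCycle.refl _ _))
  · rintro ⟨x, ⟨h1, h2⟩, rfl⟩
    refine ⟨h1, fun y hy => ?_⟩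
    obtain ⟨s, rfl⟩ := hy.exists_nat_pow_eq
    have h1' : ¬ σ.SameCycle i (e x) := h1
    change e x ≤ (σ ^ s) (e x)
    rw [horb x h1' s, e.le_iff_le]
    exact h2 _ (Equiv.Perm.sameCycle_pow_right.2 (Equiv.Perm.SameCycle.refl _ _))

end CycleTransport

section Contraction

variable {ι κ R : Type*} [Fintype ι] [LinearOrder ι] [Fintype κ] [LinearOrder κ] [Ring R]

/-- The summand of `rdet i A` that belongs to the permutation `σ`. -/
noncomputable def rdetTerm (A : Matrix ι ι R) (i : ι) (σ : Equiv.Perm ι) : R :=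
  (Equiv.Perm.sign σ : ℤ) •
    (cycleProd A σ i * (((otherLeaders σ i).sort (· ≤ ·)).map fun x => cycleProd A σ x).prod)

lemma rdet_eq_sum_rdetTerm (A : Matrix ι ι R) (i : ι) :
    rdet i A = ∑ σ : Equiv.Perm ι, rdetTerm A i σ := rfl

variable {e : κ ↪o ι} {j : κ} {l : ι} {σ : Equiv.Perm ι} {τ : Equiv.Perm κ}

lemma IsInsertion.sameCycle_iff (h : IsInsertion e j l σ τ) (x : κ) :
    σ.SameCycle (e j) (e x) ↔ τ.SameCycle j x := by
  constructor
  · intro hσ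
    by_contra hx
    obtain ⟨s, hs⟩ := hσ.symm.exists_nat_pow_eq
    rw [h.pow_apply hx, e.injective.eq_iff] at hs
    exact hx (hs ▸ Equiv.Perm.sameCycle_pow_left.2 (Equiv.Perm.SameCycle.refl _ _))
  · intro hτ
    obtain ⟨s, rfl⟩ := hτ.exists_nat_pow_eq
    induction s with
    | zero => exact Equiv.Perm.SameCycle.refl _ _
    | succ s ih =>
      have ih' := ih (Equiv.Perm.sameCycle_pow_right.2 (Equiv.Perm.SameCycle.refl _ _))
      rw [pow_succ', Equiv.Perm.mul_apply]
      by_cases hj : (τ ^ s) j = j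
      · rw [hj, ← h.apply_new, ← h.apply_base]
        simp [Equiv.Perm.SameCycle.refl]
      · rw [← h.apply_of_ne _ hj]
        simpa using ih'

lemma IsInsertion.cycleProd_base (h : IsInsertion e j l σ τ) (hl : ∀ x, e x ≠ l)
    (A : Matrix ι ι R) :
    cycleProd A σ (e j) =
      A (e j) l * cycleProd ((A.updateRow (e j) (A l)).submatrix e e) τ j := by
  rw [cycleProd, h.minimalPeriod_base hl, List.range_succ_eq_map, List.map_cons, List.prod_cons,
    List.map_map, cycleProd]
  congr 1
  · simp [h.apply_base]
  · congr 1
    refine List.map_congr_left fun s hs => ?_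
    rw [List.mem_range] at hs
    simp only [Function.comp, Nat.succ_eq_add_one, Matrix.submatrix_apply]
    rw [h.pow_apply_base hs]
    rcases s with _ | s
    · simp [h.apply_base]
    · rw [h.pow_apply_base (by omega), Matrix.updateRow_ne]
      rw [Ne, e.injective.eq_iff]
      intro h0
      exact Function.not_isPeriodicPt_of_pos_of_lt_minimalPeriod (f := τ) (x := j)
        (Nat.succ_ne_zero s) hs (by
        simpa only [Function.IsPeriodicPt, Function.IsFixedPt, Equiv.Perm.iterate_eq_pow] using h0)

lemma IsInsertion.prod_otherLeaders (h : IsInsertion e j l σ τ)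
    (he : ∀ z, z ≠ l → ∃ x, e x = z) (A : Matrix ι ι R) :
    (((otherLeaders σ (e j)).sort (· ≤ ·)).map fun x => cycleProd A σ x).prod =
      (((otherLeaders τ j).sort (· ≤ ·)).map fun x =>
        cycleProd ((A.updateRow (e j) (A l)).submatrix e e) τ x).prod := by
  classical
  rw [otherLeaders_eq_map (e := e) (τ := τ)]
  · simp only [h.sameCycle_iff]
    refine prod_sort_map _ _ _ fun x hx => ?_
    simp only [Finset.mem_filter, Finset.mem_univ, true_and] at hx
    refine cycleProd_eq_of_orbit (h.pow_apply hx.1) fun s y => ?_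
    rw [Matrix.submatrix_apply, Matrix.updateRow_ne]
    rw [Ne, e.injective.eq_iff]
    intro h0
    have : τ.SameCycle ((τ ^ s) x) x :=
      Equiv.Perm.sameCycle_pow_left.2 (Equiv.Perm.SameCycle.refl _ _)
    exact hx.1 (h0 ▸ this)
  · intro z hz
    refine he z ?_
    rintro rfl
    exact hz (h.apply_base ▸ Equiv.Perm.sameCycle_apply_right.2 (Equiv.Perm.SameCycle.refl _ _))
  · intro x hx s
    exact h.pow_apply (fun h' => hx ((h.sameCycle_iff x).2 h')) s

/-- All leaders of `τ` are the least index together with the leaders off its cycle, so the ordered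
product over all cycles is the product that enters the determinant of a Hermitian matrix. -/
lemma prod_sort_leaders [hκ : Nonempty κ] (A : Matrix κ κ R) (τ : Equiv.Perm κ)
    (s : Finset κ) (hs : ∀ x, x ∈ s ↔ ∀ y, τ.SameCycle x y → x ≤ y) :
    ((s.sort (· ≤ ·)).map fun x => cycleProd A τ x).prod =
      cycleProd A τ (Finset.univ.min' Finset.univ_nonempty) *
        (((otherLeaders τ (Finset.univ.min' Finset.univ_nonempty)).sort (· ≤ ·)).map
          fun x => cycleProd A τ x).prod := by
  classical
  set m : κ := Finset.univ.min' Finset.univ_nonempty with hm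
  have hmin : ∀ x, m ≤ x := fun x => Finset.min'_le _ _ (Finset.mem_univ x)
  have hsm : s = insert m (otherLeaders τ m) := by
    ext x
    simp only [hs, otherLeaders, Finset.mem_insert, Finset.mem_filter, Finset.mem_univ, true_and]
    constructor
    · intro hx
      by_cases hmx : τ.SameCycle m x
      · exact Or.inl (le_antisymm (hx m hmx.symm) (hmin x))
      · exact Or.inr ⟨hmx, hx⟩
    · rintro (rfl | hx)
      · exact fun y _ => hmin y
      · exact hx.2
  rw [hsm, Finset.sort_insert (· ≤ ·) (fun x _ => hmin x), List.map_cons, List.prod_cons]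
  simp [otherLeaders, Equiv.Perm.SameCycle.refl]

/-- The summand of a permutation fixing `i`, when the remaining points carry the permutation `τ`. -/
lemma rdetTerm_of_fixed [Nonempty κ] {i : ι} (hi : ∀ x, e x ≠ i) (he : ∀ z, z ≠ i → ∃ x, e x = z)
    (hσi : σ i = i) (hσ : ∀ x, σ (e x) = e (τ x))
    (hsign : Equiv.Perm.sign σ = Equiv.Perm.sign τ) (A : Matrix ι ι R) :
    rdetTerm A i σ = A i i *
      rdetTerm (A.submatrix e e) (Finset.univ.min' Finset.univ_nonempty) τ := by
  classical
  have hpow : ∀ x (s : ℕ), (σ ^ s) (e x) = e ((τ ^ s) x) := by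
    intro x s
    induction s with
    | zero => rfl
    | succ s ih => rw [pow_succ', pow_succ', Equiv.Perm.mul_apply, Equiv.Perm.mul_apply, ih, hσ]
  have hns : ∀ x, ¬ σ.SameCycle i (e x) := by
    intro x hx
    obtain ⟨s, hs⟩ := hx.symm.exists_nat_pow_eq
    exact hi _ ((hpow x s).symm.trans hs)
  have h1 : cycleProd A σ i = A i i := by
    have : Function.minimalPeriod σ i = 1 :=
      Function.minimalPeriod_eq_one_iff_isFixedPt.2 hσi
    simp [cycleProd, this, hσi]
  have h2 : (((otherLeaders σ i).sort (· ≤ ·)).map fun x => cycleProd A σ x).prod =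
      cycleProd (A.submatrix e e) τ (Finset.univ.min' Finset.univ_nonempty) *
        (((otherLeaders τ (Finset.univ.min' Finset.univ_nonempty)).sort (· ≤ ·)).map
          fun x => cycleProd (A.submatrix e e) τ x).prod := by
    rw [otherLeaders_eq_map (e := e) (τ := τ), prod_sort_map _ _
      (fun x => cycleProd (A.submatrix e e) τ x), prod_sort_leaders]
    · intro x
      simp [hns]
    · exact fun x _ => cycleProd_eq_of_orbit (hpow x) fun s y => rfl
    · intro z hz
      refine he z ?_
      rintro rfl
      exact hz (Equiv.Perm.SameCycle.refl _ _)
    · exact fun x _ s => hpow x s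
  rw [rdetTerm, rdetTerm, h1, h2, hsign, mul_smul_comm]

/-- Extension by the fixed point `l` enumerates the permutations of `ι` fixing `l` by the
permutations of `κ ≃ {l}ᶜ`. -/
lemma exists_extension (e : κ ↪o ι) {l : ι} (hl : ∀ x, e x ≠ l) (he : ∀ z, z ≠ l → ∃ x, e x = z) :
    ∃ E : Equiv.Perm κ → Equiv.Perm ι, Function.Injective E ∧
      (∀ τ, E τ l = l) ∧ (∀ τ x, E τ (e x) = e (τ x)) ∧
      (∀ τ, Equiv.Perm.sign (E τ) = Equiv.Perm.sign τ) ∧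
      ∀ σ : Equiv.Perm ι, σ l = l → ∃ τ, E τ = σ := by
  classical
  let f : κ ≃ {z // z ≠ l} := Equiv.ofBijective (fun x => ⟨e x, hl x⟩)
    ⟨fun x y h => e.injective (congrArg Subtype.val h), fun z => by
      obtain ⟨x, hx⟩ := he z.1 z.2
      exact ⟨x, Subtype.ext hx⟩⟩
  have hf : ∀ x, ((f x : {z // z ≠ l}) : ι) = e x := fun x => rfl
  refine ⟨fun τ => τ.extendDomain f, Equiv.Perm.extendDomainHom_injective f, fun τ => ?_,
    fun τ x => ?_, fun τ => Equiv.Perm.sign_extendDomain τ f, fun σ hσ => ?_⟩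
  · exact Equiv.Perm.extendDomain_apply_not_subtype _ _ (by simp)
  · rw [← hf, Equiv.Perm.extendDomain_apply_image, hf]
  · have hp : ∀ z, σ z ≠ l ↔ z ≠ l := fun z => by
      conv_lhs => rw [← hσ]
      rw [Ne, σ.injective.eq_iff]
    refine ⟨f.symm.permCongr (σ.subtypePerm hp), ?_⟩
    ext z
    by_cases hz : z = l
    · rw [hz, hσ]
      exact Equiv.Perm.extendDomain_apply_not_subtype _ _ (by simp)
    · obtain ⟨x, rfl⟩ := he z hz
      conv_lhs => rw [← hf]
      rw [Equiv.Perm.extendDomain_apply_image]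
      simp [Equiv.permCongr_apply, hf]

/-- The permutations fixing `i` contribute `a_{ii}` times the determinant of the complementary
principal submatrix. -/
lemma sum_rdetTerm_fixed {i : ι} (e : κ ↪o ι) (hi : ∀ x, e x ≠ i)
    (he : ∀ z, z ≠ i → ∃ x, e x = z) (A : Matrix ι ι R) :
    ∑ σ : Equiv.Perm ι with σ i = i, rdetTerm A i σ = A i i * hermDet (A.submatrix e e) := by
  classical
  obtain ⟨E, hinj, hEi, hEe, hsign, hsurj⟩ := exists_extension e hi he
  rcases isEmpty_or_nonempty κ with hκ | hκ
  · have hi' : ∀ z : ι, z = i := fun z => by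
      by_contra hz
      obtain ⟨x, -⟩ := he z hz
      exact hκ.elim x
    have : Subsingleton ι := ⟨fun a b => (hi' a).trans (hi' b).symm⟩
    have hU : (Finset.univ.filter fun σ : Equiv.Perm ι => σ i = i) = {1} := by
      ext σ
      simp [Subsingleton.elim σ 1]
    have hO : otherLeaders (1 : Equiv.Perm ι) i = ∅ := by
      refine Finset.eq_empty_of_forall_notMem fun x hx => ?_
      simp only [otherLeaders, Finset.mem_filter] at hx
      exact hx.2.1 (hi' x ▸ Equiv.Perm.SameCycle.refl _ _)
    rw [hU, Finset.sum_singleton, rdetTerm, hO]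
    simp [hermDet, cycleProd]
  · rw [hermDet, dif_pos Finset.univ_nonempty, rdet_eq_sum_rdetTerm, Finset.mul_sum]
    symm
    refine Finset.sum_bij (fun τ _ => E τ) (fun τ _ => by simp [hEi]) (fun a _ b _ h => hinj h)
      (fun σ hσ => ?_) (fun τ _ => ?_)
    · obtain ⟨τ, hτ⟩ := hsurj σ (by simpa using hσ)
      exact ⟨τ, Finset.mem_univ _, hτ⟩
    · exact (rdetTerm_of_fixed hi he (hEi τ) (hEe τ) (hsign τ) A).symm

/-- The permutations sending `j` to another index `l` contribute `-a_{jl}` times a row determinant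
of order one less: contract `l` into `j`. -/
lemma sum_rdetTerm_moved (e : κ ↪o ι) (j : κ) {l : ι} (hl : ∀ x, e x ≠ l)
    (he : ∀ z, z ≠ l → ∃ x, e x = z) (A : Matrix ι ι R) :
    ∑ σ : Equiv.Perm ι with σ (e j) = l, rdetTerm A (e j) σ =
      -(A (e j) l * rdet j ((A.updateRow (e j) (A l)).submatrix e e)) := by
  classical
  obtain ⟨E, hinj, hEl, hEe, hsign, hsurj⟩ := exists_extension e hl he
  rw [rdet_eq_sum_rdetTerm, Finset.mul_sum, ← Finset.sum_neg_distrib]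
  symm
  refine Finset.sum_bij (fun τ _ => E τ * Equiv.swap (e j) l) (fun τ _ => by simp [hEl])
    (fun a _ b _ h => hinj (mul_right_cancel h)) (fun σ hσ => ?_) (fun τ _ => ?_)
  · obtain ⟨τ, hτ⟩ := hsurj (σ * Equiv.swap (e j) l) (by simpa using hσ)
    exact ⟨τ, Finset.mem_univ _, by rw [hτ, mul_assoc, Equiv.swap_mul_self, mul_one]⟩
  · have h : IsInsertion e j l (E τ * Equiv.swap (e j) l) τ :=
      { apply_base := by simp [hEl]
        apply_new := by simp [hEe]
        apply_of_ne := fun x hx => by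
          rw [Equiv.Perm.mul_apply, Equiv.swap_apply_of_ne_of_ne (e.injective.ne hx) (hl x), hEe] }
    rw [rdetTerm, rdetTerm, h.cycleProd_base hl, h.prod_otherLeaders he, Equiv.Perm.sign_mul,
      Equiv.Perm.sign_swap (hl j), hsign, mul_smul_comm, mul_assoc]
    simp

end Contraction

end QuaternionMatrix

/-! ### Path sums and convolution of set functions -/

namespace QuaternionMatrix

section DisjConv

variable {ι R : Type*} [DecidableEq ι] [Ring R]

/-- The convolution of set functions over splittings of a finite set into two disjoint parts. -/
def disjConv (f g : Finset ι → R) (T : Finset ι) : R :=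
  ∑ U ∈ T.powerset, f U * g (T \ U)

lemma disjConv_congr {f g g' : Finset ι → R} {T : Finset ι} (h : ∀ V ⊆ T, g V = g' V) :
    disjConv f g T = disjConv f g' T :=
  Finset.sum_congr rfl fun U _ => by rw [h _ Finset.sdiff_subset]

lemma sum_powerset_compl {M : Type*} [AddCommMonoid M] (F : Finset ι → Finset ι → M)
    (T : Finset ι) :
    ∑ U ∈ T.powerset, F U (T \ U) = ∑ U ∈ T.powerset, F (T \ U) U := by
  refine Finset.sum_nbij' (fun U => T \ U) (fun U => T \ U) ?_ ?_ ?_ ?_ ?_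
  · exact fun U _ => Finset.mem_powerset.2 Finset.sdiff_subset
  · exact fun U _ => Finset.mem_powerset.2 Finset.sdiff_subset
  · exact fun U hU => Finset.sdiff_sdiff_eq_self (Finset.mem_powerset.1 hU)
  · exact fun U hU => Finset.sdiff_sdiff_eq_self (Finset.mem_powerset.1 hU)
  · intro U hU
    rw [Finset.sdiff_sdiff_eq_self (Finset.mem_powerset.1 hU)]

lemma disjConv_comm {f g : Finset ι → R} (h : ∀ U V, f U * g V = g V * f U) :
    disjConv f g = disjConv g f := by
  funext T
  rw [disjConv, sum_powerset_compl fun U V => f U * g V]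
  exact Finset.sum_congr rfl fun U _ => h _ _

lemma disjConv_assoc (f g h : Finset ι → R) :
    disjConv (disjConv f g) h = disjConv f (disjConv g h) := by
  funext T
  simp only [disjConv, Finset.sum_mul, Finset.mul_sum]
  rw [Finset.sum_sigma', Finset.sum_sigma']
  refine Finset.sum_nbij' (fun p => ⟨p.2, p.1 \ p.2⟩) (fun p => ⟨p.1 ∪ p.2, p.1⟩) ?_ ?_ ?_ ?_ ?_
  · rintro ⟨W, U⟩ h
    simp only [Finset.mem_sigma, Finset.mem_powerset] at h ⊢
    exact ⟨h.2.trans h.1, Finset.sdiff_subset_sdiff h.1 le_rfl⟩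
  · rintro ⟨U, V⟩ h
    simp only [Finset.mem_sigma, Finset.mem_powerset] at h ⊢
    exact ⟨Finset.union_subset h.1 (h.2.trans Finset.sdiff_subset), Finset.subset_union_left⟩
  · rintro ⟨W, U⟩ h
    simp only [Finset.mem_sigma, Finset.mem_powerset] at h
    simp [Finset.union_eq_right.2 h.2]
  · rintro ⟨U, V⟩ h
    simp only [Finset.mem_sigma, Finset.mem_powerset] at h
    have : Disjoint U V := (Finset.subset_sdiff.1 h.2).2.symm
    simp [Finset.union_sdiff_cancel_left this]
  · rintro ⟨W, U⟩ h
    simp only [Finset.mem_sigma, Finset.mem_powerset] at h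
    simp only [mul_assoc]
    congr 3
    rw [sdiff_sdiff_left, Finset.sup_eq_union, Finset.union_sdiff_of_subset h.2]

/-- Splitting a convolution over `T ∪ {i}` by the part that receives the new point. -/
lemma disjConv_insert (f g : Finset ι → R) {i : ι} {T : Finset ι} (hi : i ∉ T) :
    disjConv f g (insert i T) =
      disjConv f (fun V => g (insert i V)) T + disjConv (fun U => f (insert i U)) g T := by
  rw [disjConv, Finset.sum_powerset_insert hi]
  congr 1
  · refine Finset.sum_congr rfl fun U hU => ?_
    rw [Finset.insert_sdiff_of_notMem _ fun h => hi (Finset.mem_powerset.1 hU h)]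
  · refine Finset.sum_congr rfl fun U hU => ?_
    rw [Finset.insert_sdiff_insert, Finset.sdiff_insert_of_notMem hi]

end DisjConv

section PathSum

variable {ι R : Type*} [DecidableEq ι] [Ring R]

/-- The signed sum of the products of entries of `H` along the paths that lead from `a` to `j` and
visit every point of `U` exactly once in between: the sign is `(-1)^|U|`. -/
def pathSum (H : Matrix ι ι R) (U : Finset ι) (a j : ι) : R :=
  (if U = ∅ then H a j else 0) - ∑ l ∈ U.attach, H a l * pathSum H (U.erase l) l j
termination_by U.card
decreasing_by exact Finset.card_erase_lt_of_mem l.2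

/-- The recursion of `pathSum` at the first step of the path. -/
lemma pathSum_eq (H : Matrix ι ι R) (U : Finset ι) (a j : ι) :
    pathSum H U a j =
      (if U = ∅ then H a j else 0) - ∑ l ∈ U, H a l * pathSum H (U.erase l) l j := by
  rw [pathSum, ← Finset.sum_attach U]

lemma sum_erase_comm {M : Type*} [AddCommMonoid M] (U : Finset ι) (F : ι → ι → M) :
    ∑ l ∈ U, ∑ m ∈ U.erase l, F l m = ∑ m ∈ U, ∑ l ∈ U.erase m, F l m :=
  Finset.sum_comm' (by
    intro l m
    simp only [Finset.mem_erase]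
    tauto)

/-- The recursion of `pathSum` at the last step of the path. -/
lemma pathSum_eq_right (H : Matrix ι ι R) (U : Finset ι) (a j : ι) :
    pathSum H U a j =
      (if U = ∅ then H a j else 0) - ∑ l ∈ U, pathSum H (U.erase l) a l * H l j := by
  induction U using Finset.strongInduction generalizing a with
  | H U ih =>
    rw [pathSum_eq]
    congr 1
    have h1 : ∀ l ∈ U, H a l * pathSum H (U.erase l) l j =
        (if U.erase l = ∅ then H a l * H l j else 0) -
          ∑ m ∈ U.erase l, H a l * pathSum H ((U.erase l).erase m) l m * H m j := by
      intro l hl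
      rw [ih _ (Finset.erase_ssubset hl), mul_sub, Finset.mul_sum]
      simp only [mul_ite, mul_zero, mul_assoc]
    have h2 : ∀ m ∈ U, pathSum H (U.erase m) a m * H m j =
        (if U.erase m = ∅ then H a m * H m j else 0) -
          ∑ l ∈ U.erase m, H a l * pathSum H ((U.erase l).erase m) l m * H m j := by
      intro m _
      rw [pathSum_eq, sub_mul, Finset.sum_mul]
      simp only [ite_mul, zero_mul]
      congr 1
      exact Finset.sum_congr rfl fun l _ => by rw [Finset.erase_right_comm]
    rw [Finset.sum_congr rfl h1, Finset.sum_congr rfl h2, Finset.sum_sub_distrib,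
      Finset.sum_sub_distrib, sum_erase_comm]

/-- The recursion at the first step, carried over to convolutions with an arbitrary set function. -/
lemma disjConv_pathSum (H : Matrix ι ι R) (g : Finset ι → R) (a j : ι) (T : Finset ι) :
    disjConv (fun U => pathSum H U a j) g T =
      H a j * g T - ∑ l ∈ T, H a l * disjConv (fun U => pathSum H U l j) g (T.erase l) := by
  have h1 : disjConv (fun U => pathSum H U a j) g T =
      ∑ U ∈ T.powerset, (if U = ∅ then H a j else 0) * g (T \ U) -
        ∑ U ∈ T.powerset, ∑ l ∈ U, H a l * pathSum H (U.erase l) l j * g (T \ U) := by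
    rw [disjConv, ← Finset.sum_sub_distrib]
    refine Finset.sum_congr rfl fun U _ => ?_
    simp only [pathSum_eq H U a j, sub_mul, Finset.sum_mul]
  rw [h1]
  congr 1
  · rw [Finset.sum_eq_single ∅]
    · simp
    · intro U _ hU
      simp [hU]
    · simp
  · simp only [disjConv, Finset.mul_sum]
    rw [Finset.sum_sigma', Finset.sum_sigma']
    refine Finset.sum_nbij' (fun p => ⟨p.2, p.1.erase p.2⟩) (fun p => ⟨insert p.1 p.2, p.1⟩)
      ?_ ?_ ?_ ?_ ?_
    · rintro ⟨U, l⟩ h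
      simp only [Finset.mem_sigma, Finset.mem_powerset] at h ⊢
      exact ⟨h.1 h.2, Finset.erase_subset_erase _ h.1⟩
    · rintro ⟨l, U⟩ h
      simp only [Finset.mem_sigma, Finset.mem_powerset] at h ⊢
      exact ⟨Finset.insert_subset h.1 (h.2.trans (Finset.erase_subset _ _)),
        Finset.mem_insert_self _ _⟩
    · rintro ⟨U, l⟩ h
      simp only [Finset.mem_sigma, Finset.mem_powerset] at h
      simp [Finset.insert_erase h.2]
    · rintro ⟨l, U⟩ h
      simp only [Finset.mem_sigma, Finset.mem_powerset] at h
      have : l ∉ U := fun hl => Finset.notMem_erase l T (h.2 hl)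
      simp [Finset.erase_insert this]
    · rintro ⟨U, l⟩ h
      simp only [Finset.mem_sigma, Finset.mem_powerset] at h
      simp only [mul_assoc]
      congr 3
      ext x
      simp only [Finset.mem_sdiff, Finset.mem_erase]
      constructor
      · rintro ⟨hx, hxU⟩
        exact ⟨⟨fun h' => hxU (h' ▸ h.2), hx⟩, fun h' => hxU h'.2⟩
      · rintro ⟨⟨hxl, hx⟩, hxU⟩
        exact ⟨hx, fun h' => hxU ⟨hxl, h'⟩⟩

/-- A path through `T ∪ {i}` splits at `i`. -/
lemma pathSum_insert (H : Matrix ι ι R) {i : ι} {T : Finset ι} (hi : i ∉ T) (a j : ι) :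
    pathSum H (insert i T) a j =
      -disjConv (fun U => pathSum H U a i) (fun U => pathSum H U i j) T := by
  induction T using Finset.strongInduction generalizing a with
  | H T ih =>
    have h : ∑ l ∈ T, H a l * pathSum H ((insert i T).erase l) l j =
        -∑ l ∈ T, H a l *
          disjConv (fun U => pathSum H U l i) (fun U => pathSum H U i j) (T.erase l) := by
      rw [← Finset.sum_neg_distrib (fun l => H a l * disjConv _ _ (T.erase l))]
      refine Finset.sum_congr rfl fun l hl => ?_
      have hil : i ≠ l := fun h => hi (h ▸ hl)
      rw [Finset.erase_insert_of_ne hil, ih _ (Finset.erase_ssubset hl)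
        (fun h => hi (Finset.mem_of_mem_erase h)), mul_neg]
    rw [pathSum_eq, disjConv_pathSum, if_neg (Finset.insert_ne_empty _ _), Finset.sum_insert hi,
      Finset.erase_insert hi, h]
    abel

lemma disjConv_pathSum_insert (H : Matrix ι ι R) (g : Finset ι → R) {i : ι} {T : Finset ι}
    (hi : i ∉ T) (a j : ι) :
    disjConv (fun U => pathSum H U a j) g (insert i T) =
      disjConv (fun U => pathSum H U a j) (fun V => g (insert i V)) T -
        disjConv (disjConv (fun U => pathSum H U a i) (fun U => pathSum H U i j)) g T := by
  rw [disjConv_insert _ _ hi, sub_eq_add_neg]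
  congr 1
  rw [disjConv, disjConv, ← Finset.sum_neg_distrib]
  refine Finset.sum_congr rfl fun U hU => ?_
  rw [pathSum_insert H (fun h => hi (Finset.mem_powerset.1 hU h)), neg_mul]

/-- For a Hermitian matrix, reversing a path conjugates its product. -/
lemma star_pathSum [StarRing R] {H : Matrix ι ι R} (hH : H.IsHermitian) (U : Finset ι) (a j : ι) :
    star (pathSum H U a j) = pathSum H U j a := by
  induction U using Finset.strongInduction generalizing a with
  | H U ih =>
    rw [pathSum_eq, pathSum_eq_right H U j a, star_sub, star_sum]
    congr 1
    · split_ifs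
      · exact hH.apply j a
      · exact star_zero _
    · refine Finset.sum_congr rfl fun l hl => ?_
      rw [star_mul, ih _ (Finset.erase_ssubset hl), hH.apply l a]

end PathSum

end QuaternionMatrix

/-! ### Minors of Hermitian quaternion matrices -/

namespace QuaternionMatrix

section HermitianPathSum

variable {ι : Type*} [DecidableEq ι] {H : Matrix ι ι ℍ[ℝ]}

lemma coe_re_of_star_eq {x : ℍ[ℝ]} (hx : star x = x) : ((x.re : ℝ) : ℍ[ℝ]) = x :=
  (Quaternion.star_eq_self.1 hx).symm

lemma mul_comm_of_star_eq {x : ℍ[ℝ]} (hx : star x = x) (y : ℍ[ℝ]) : x * y = y * x := by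
  rw [← coe_re_of_star_eq hx]
  exact Quaternion.coe_commutes _ _

lemma re_mul_comm (x y : ℍ[ℝ]) : (x * y).re = (y * x).re := by
  simp only [Quaternion.re_mul]
  ring

lemma re_sum {α : Type*} (s : Finset α) (f : α → ℍ[ℝ]) : (∑ x ∈ s, f x).re = ∑ x ∈ s, (f x).re :=
  map_sum (AddMonoidHom.mk' (fun x : ℍ[ℝ] => x.re) fun _ _ => rfl) f s

/-- Both sides are real, and the real part of a product is symmetric in the two factors. -/
lemma disjConv_pathSum_comm (hH : H.IsHermitian) (i m : ι) :
    disjConv (fun U => pathSum H U m i) (fun U => pathSum H U i m) =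
      disjConv (fun U => pathSum H U i m) (fun U => pathSum H U m i) := by
  have hs : ∀ (i m : ι) (T : Finset ι),
      star (disjConv (fun U => pathSum H U m i) (fun U => pathSum H U i m) T) =
        disjConv (fun U => pathSum H U m i) (fun U => pathSum H U i m) T := by
    intro i m T
    simp only [disjConv, star_sum, star_mul, star_pathSum hH]
    exact (sum_powerset_compl (fun U V => pathSum H U m i * pathSum H V i m) T).symm
  funext T
  rw [← coe_re_of_star_eq (hs i m T), ← coe_re_of_star_eq (hs m i T)]
  congr 1
  simp only [disjConv, re_sum]
  rw [sum_powerset_compl (fun U V => (pathSum H U m i * pathSum H V i m).re)]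
  exact Finset.sum_congr rfl fun U _ => re_mul_comm _ _

/-- A function that behaves like the determinant on the index sets of principal submatrices of
`H`: every set is expanded along the row of one of its elements. -/
structure IsMinorFunction (H : Matrix ι ι ℍ[ℝ]) (D : Finset ι → ℍ[ℝ]) : Prop where
  empty : D ∅ = 1
  expand : ∀ T : Finset ι, T.Nonempty →
    ∃ m ∈ T, D T = disjConv (fun U => pathSum H U m m) D (T.erase m)

variable {D : Finset ι → ℍ[ℝ]}

lemma IsMinorFunction.star_eq (hD : IsMinorFunction H D) (hH : H.IsHermitian) (T : Finset ι) :
    star (D T) = D T := by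
  induction T using Finset.strongInduction with
  | H T ih =>
    rcases T.eq_empty_or_nonempty with rfl | hT
    · rw [hD.empty, star_one]
    · obtain ⟨m, hm, h⟩ := hD.expand T hT
      rw [h, disjConv, star_sum]
      refine Finset.sum_congr rfl fun U hU => ?_
      have hlt : T.erase m \ U ⊂ T :=
        lt_of_le_of_lt Finset.sdiff_subset (Finset.erase_ssubset hm)
      rw [star_mul, ih _ hlt, star_pathSum hH, mul_comm_of_star_eq (ih _ hlt)]

/-- The expansion along a row does not depend on the row. Expanding along two rows `m` and `i`, in
either order, leaves the products of closed paths at `m` and at `i`, which are real and commute, and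
the closed paths through both points, whose sum is real and symmetric. -/
lemma IsMinorFunction.expand_insert (hD : IsMinorFunction H D) (hH : H.IsHermitian)
    {i : ι} {T : Finset ι} (hi : i ∉ T) :
    D (insert i T) = disjConv (fun U => pathSum H U i i) D T := by
  induction T using Finset.strongInduction generalizing i with
  | H T ih =>
    obtain ⟨m, hm, h⟩ := hD.expand (insert i T) (Finset.insert_nonempty _ _)
    rcases Finset.mem_insert.1 hm with rfl | hmT
    · rwa [Finset.erase_insert hi] at h
    · obtain ⟨S, hmS, rfl⟩ : ∃ S, m ∉ S ∧ insert m S = T :=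
        ⟨T.erase m, Finset.notMem_erase _ _, Finset.insert_erase hmT⟩
      have hiS : i ∉ S := fun h' => hi (Finset.mem_insert_of_mem h')
      have him : i ≠ m := fun h' => hi (h' ▸ Finset.mem_insert_self _ _)
      have hlt : ∀ V ⊆ S, V ⊂ insert m S := fun V hV =>
        lt_of_le_of_lt hV (Finset.ssubset_insert hmS)
      rw [h, Finset.erase_insert_of_ne him, Finset.erase_insert hmS,
        disjConv_pathSum_insert H D hiS, disjConv_pathSum_insert H D hmS,
        disjConv_congr (fun V hV => ih V (hlt V hV) fun h' => hiS (hV h')),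
        disjConv_congr (fun V hV => ih V (hlt V hV) fun h' => hmS (hV h')),
        ← disjConv_assoc, ← disjConv_assoc, disjConv_pathSum_comm hH i m,
        disjConv_comm (f := fun U => pathSum H U m m) (g := fun U => pathSum H U i i)
          fun U V => mul_comm_of_star_eq (star_pathSum hH U m m) _]

/-- A row determinant with two equal rows vanishes: the paths that return to `i` cancel against the
cycles through `i` in the complement. -/
lemma IsMinorFunction.disjConv_eq_zero_of_mem_left (hD : IsMinorFunction H D) (hH : H.IsHermitian)
    {i : ι} (j : ι) {T : Finset ι} (hi : i ∈ T) :
    disjConv (fun U => pathSum H U i j) D T = 0 := by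
  rw [← Finset.insert_erase hi, disjConv_pathSum_insert H D (Finset.notMem_erase _ _),
    disjConv_congr (fun V hV => hD.expand_insert hH fun h' => Finset.notMem_erase i T (hV h')),
    ← disjConv_assoc, disjConv_comm (f := fun U => pathSum H U i i)
      fun U V => mul_comm_of_star_eq (star_pathSum hH U i i) _, sub_self]

/-- The counterpart of `disjConv_eq_zero_of_mem_left` for two equal columns. -/
lemma IsMinorFunction.disjConv_eq_zero_of_mem_right (hD : IsMinorFunction H D)
    (hH : H.IsHermitian) (i : ι) {j : ι} {T : Finset ι} (hj : j ∈ T) :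
    disjConv (fun U => pathSum H U i j) D T = 0 := by
  rw [← Finset.insert_erase hj, disjConv_pathSum_insert H D (Finset.notMem_erase _ _),
    disjConv_congr (fun V hV => hD.expand_insert hH fun h' => Finset.notMem_erase j T (hV h')),
    ← disjConv_assoc, sub_self]

end HermitianPathSum

section PrincipalMinors

variable {n : ℕ}

/-- The determinant of the principal submatrix of `H` indexed by `S`. -/
noncomputable def minor (H : Matrix (Fin n) (Fin n) ℍ[ℝ]) (S : Finset (Fin n)) : ℍ[ℝ] :=
  hermDet (principal H S)

/-- The `j`-th row determinant of the principal submatrix indexed by `S`, after the `j`-th row of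
`H` has been replaced by `b`; zero if `j` does not belong to `S`. -/
noncomputable def rowMinor (H : Matrix (Fin n) (Fin n) ℍ[ℝ]) (S : Finset (Fin n))
    (b : Fin n → ℍ[ℝ]) (j : Fin n) : ℍ[ℝ] :=
  if h : j ∈ S then rdet ⟨j, h⟩ (principal (H.updateRow j b) S) else 0

lemma minor_empty (H : Matrix (Fin n) (Fin n) ℍ[ℝ]) : minor H ∅ = 1 := by
  rw [minor, hermDet, dif_neg]
  simp

lemma exists_minor_eq_rowMinor (H : Matrix (Fin n) (Fin n) ℍ[ℝ]) {S : Finset (Fin n)}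
    (hS : S.Nonempty) : ∃ m ∈ S, minor H S = rowMinor H S (H m) m := by
  have hne : (Finset.univ : Finset {x // x ∈ S}).Nonempty := by
    obtain ⟨x, hx⟩ := hS
    exact ⟨⟨x, hx⟩, Finset.mem_univ _⟩
  refine ⟨(Finset.univ.min' hne).1, (Finset.univ.min' hne).2, ?_⟩
  rw [rowMinor, dif_pos (Finset.univ.min' hne).2, Matrix.updateRow_eq_self, minor, hermDet,
    dif_pos hne]

/-- The inclusion of a principal index set into a larger one. -/
def principalEmb {S T : Finset (Fin n)} (h : S ⊆ T) : {x // x ∈ S} ↪o {x // x ∈ T} where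
  toFun x := ⟨x.1, h x.2⟩
  inj' _ _ hxy := Subtype.ext (congrArg (fun z : {x // x ∈ T} => z.1) hxy)
  map_rel_iff' := Iff.rfl

@[simp]
lemma coe_principalEmb {S T : Finset (Fin n)} (h : S ⊆ T) (x : {x // x ∈ S}) :
    (principalEmb h x : Fin n) = x := rfl

lemma principal_apply (H : Matrix (Fin n) (Fin n) ℍ[ℝ]) (S : Finset (Fin n)) (x y : {x // x ∈ S}) :
    principal H S x y = H x y := rfl

/-- Expansion of a row determinant along its row: grouping the permutations by the image of `j`
contracts that image into `j`. No symmetry of `H` is needed. -/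
lemma rowMinor_insert (H : Matrix (Fin n) (Fin n) ℍ[ℝ]) {T : Finset (Fin n)} {j : Fin n}
    (hj : j ∉ T) (b : Fin n → ℍ[ℝ]) :
    rowMinor H (insert j T) b j =
      b j * minor H T - ∑ l ∈ T, b l * rowMinor H (insert j (T.erase l)) (H l) j := by
  classical
  set j' : {x // x ∈ insert j T} := ⟨j, Finset.mem_insert_self j T⟩ with hj'
  have hsum : rowMinor H (insert j T) b j = ∑ l : {x // x ∈ insert j T},
      ∑ σ : Equiv.Perm {x // x ∈ insert j T} with σ j' = l,
        rdetTerm (principal (H.updateRow j b) (insert j T)) j' σ := by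
    rw [rowMinor, dif_pos (Finset.mem_insert_self j T), rdet_eq_sum_rdetTerm]
    exact (Finset.sum_fiberwise _ _ _).symm
  have hfix : ∑ σ : Equiv.Perm {x // x ∈ insert j T} with σ j' = j',
      rdetTerm (principal (H.updateRow j b) (insert j T)) j' σ = b j * minor H T := by
    refine (sum_rdetTerm_fixed (principalEmb (Finset.subset_insert j T)) ?_ ?_ _).trans ?_
    rotate_left 2
    · congr 1
      · simp [principal_apply, hj']
      · rw [minor]
        congr 1
        ext1 x y
        have hx : (x : Fin n) ≠ j := fun h => hj (h ▸ x.2)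
        simp [principal_apply, hx]
    · intro x hx
      have hx' : (x : Fin n) = j := congrArg Subtype.val hx
      exact hj (hx' ▸ x.2)
    · rintro ⟨z, hz⟩ hne
      have hz' : z ∈ T := (Finset.mem_insert.1 hz).resolve_left fun h => hne (Subtype.ext h)
      exact ⟨⟨z, hz'⟩, rfl⟩
  have hmove : ∀ l (hl : l ∈ T), ∑ σ : Equiv.Perm {x // x ∈ insert j T} with
      σ j' = ⟨l, Finset.mem_insert_of_mem hl⟩,
      rdetTerm (principal (H.updateRow j b) (insert j T)) j' σ =
        -(b l * rowMinor H (insert j (T.erase l)) (H l) j) := by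
    intro l hl
    have hlj : l ≠ j := fun h => hj (h ▸ hl)
    have hsub : insert j (T.erase l) ⊆ insert j T :=
      Finset.insert_subset_insert _ (Finset.erase_subset _ _)
    have := sum_rdetTerm_moved (principalEmb hsub)
      ⟨j, Finset.mem_insert_self j (T.erase l)⟩ (l := ⟨l, Finset.mem_insert_of_mem hl⟩)
      ?_ ?_ (principal (H.updateRow j b) (insert j T))
    · refine this.trans ?_
      rw [rowMinor, dif_pos (Finset.mem_insert_self _ _)]
      congr 2
      · simp [principal_apply]
      · congr 1
        ext1 x y
        by_cases hx : (x : Fin n) = j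
        · obtain ⟨x, hx'⟩ := x
          obtain rfl : x = j := hx
          simp [principal_apply, hlj]
        · have hx2 : principalEmb hsub x ≠
              principalEmb hsub ⟨j, Finset.mem_insert_self j (T.erase l)⟩ := fun h =>
            hx (congrArg Subtype.val h)
          refine (congrFun (Matrix.updateRow_ne hx2) _).trans ?_
          simp [principal_apply, hx]
    · intro x hx
      have hx' : (x : Fin n) = l := congrArg Subtype.val hx
      have := x.2
      rw [hx'] at this
      simp [hlj] at this
    · rintro ⟨z, hz⟩ hne
      have hz' : z ∈ insert j (T.erase l) := by
        rcases Finset.mem_insert.1 hz with rfl | hzT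
        · exact Finset.mem_insert_self _ _
        · exact Finset.mem_insert_of_mem (Finset.mem_erase.2 ⟨fun h => hne (Subtype.ext h), hzT⟩)
      exact ⟨⟨z, hz'⟩, rfl⟩
  rw [hsum]
  have hconv := Finset.sum_coe_sort (insert j T) (fun l => if h : l ∈ insert j T then
    ∑ σ : Equiv.Perm {x // x ∈ insert j T} with σ j' = ⟨l, h⟩,
      rdetTerm (principal (H.updateRow j b) (insert j T)) j' σ else 0)
  simp only [Finset.coe_mem, dif_pos, Subtype.coe_eta] at hconv
  rw [hconv, Finset.sum_insert hj, dif_pos (Finset.mem_insert_self j T), hfix, sub_eq_add_neg,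
    ← Finset.sum_neg_distrib (fun l => b l * rowMinor H (insert j (T.erase l)) (H l) j)]
  congr 1
  refine Finset.sum_congr rfl fun l hl => ?_
  rw [dif_pos (Finset.mem_insert_of_mem hl), hmove l hl]

lemma rowMinor_insert_row (H : Matrix (Fin n) (Fin n) ℍ[ℝ]) {T : Finset (Fin n)} {j : Fin n}
    (hj : j ∉ T) (a : Fin n) :
    rowMinor H (insert j T) (H a) j = disjConv (fun U => pathSum H U a j) (minor H) T := by
  induction T using Finset.strongInduction generalizing a with
  | H T ih =>
    rw [rowMinor_insert H hj, disjConv_pathSum]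
    congr 1
    refine Finset.sum_congr rfl fun l hl => ?_
    rw [ih _ (Finset.erase_ssubset hl) fun h => hj (Finset.mem_of_mem_erase h)]

lemma isMinorFunction_minor (H : Matrix (Fin n) (Fin n) ℍ[ℝ]) : IsMinorFunction H (minor H) where
  empty := minor_empty H
  expand T hT := by
    obtain ⟨m, hm, h⟩ := exists_minor_eq_rowMinor H hT
    refine ⟨m, hm, ?_⟩
    rw [h, ← rowMinor_insert_row H (Finset.notMem_erase m T), Finset.insert_erase hm]

end PrincipalMinors

end QuaternionMatrix

/-! ### Sums of adjugates of principal submatrices -/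

namespace QuaternionMatrix

section Adjugates

variable {n : ℕ}

lemma sumPrincipalMinors_eq (s : ℕ) (H : Matrix (Fin n) (Fin n) ℍ[ℝ]) :
    sumPrincipalMinors s H = ∑ T ∈ Finset.univ.powersetCard s, minor H T := by
  rw [Finset.sum_subtype (Finset.univ.powersetCard s) (p := fun α => α.card = s) (by simp)]
  rfl

/-- Summing over a set with a distinguished element is summing over the rest of the set. -/
lemma sum_powersetCard_sum_erase {M : Type*} [AddCommMonoid M] (s : ℕ)
    (F : Fin n → Finset (Fin n) → M) :
    ∑ T ∈ (Finset.univ : Finset (Fin n)).powersetCard (s + 1), ∑ l ∈ T, F l (T.erase l) =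
      ∑ l, ∑ V ∈ (Finset.univ : Finset (Fin n)).powersetCard s with l ∉ V, F l V := by
  rw [Finset.sum_sigma', Finset.sum_sigma']
  refine Finset.sum_nbij' (fun p => ⟨p.2, p.1.erase p.2⟩) (fun p => ⟨insert p.1 p.2, p.1⟩)
    ?_ ?_ ?_ ?_ ?_
  · rintro ⟨T, l⟩ h
    simp only [Finset.mem_sigma, Finset.mem_powersetCard_univ] at h
    simp [Finset.card_erase_of_mem h.2, h.1]
  · rintro ⟨l, V⟩ h
    simp only [Finset.mem_sigma, Finset.mem_filter, Finset.mem_powersetCard_univ] at h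
    simp [Finset.card_insert_of_notMem h.2.2, h.2.1]
  · rintro ⟨T, l⟩ h
    simp only [Finset.mem_sigma] at h
    simp [Finset.insert_erase h.2]
  · rintro ⟨l, V⟩ h
    simp only [Finset.mem_sigma, Finset.mem_filter] at h
    simp [Finset.erase_insert h.2.2]
  · rintro ⟨T, l⟩ h
    rfl

lemma sumRdet_eq (s : ℕ) (j : Fin n) (H : Matrix (Fin n) (Fin n) ℍ[ℝ]) (b : Fin n → ℍ[ℝ]) :
    sumRdet (s + 1) j (H.updateRow j b) =
      ∑ V ∈ (Finset.univ : Finset (Fin n)).powersetCard s with j ∉ V,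
        rowMinor H (insert j V) b j := by
  have h1 : sumRdet (s + 1) j (H.updateRow j b) =
      ∑ α ∈ (Finset.univ : Finset (Fin n)).powersetCard (s + 1) with j ∈ α,
        rowMinor H α b j := by
    rw [Finset.sum_subtype _ (p := fun α => α.card = s + 1 ∧ j ∈ α) (by simp)]
    exact Finset.sum_congr rfl fun α _ => by rw [rowMinor, dif_pos α.2.2]
  rw [h1]
  refine Finset.sum_nbij' (fun α => α.erase j) (fun V => insert j V) ?_ ?_ ?_ ?_ ?_
  · intro α h
    simp only [Finset.mem_filter, Finset.mem_powersetCard_univ] at h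
    simp [Finset.card_erase_of_mem h.2, h.1]
  · intro V h
    simp only [Finset.mem_filter, Finset.mem_powersetCard_univ] at h
    simp [Finset.card_insert_of_notMem h.2, h.1]
  · intro α h
    exact Finset.insert_erase (Finset.mem_filter.1 h).2
  · intro V h
    exact Finset.erase_insert (Finset.mem_filter.1 h).2
  · intro α h
    rw [Finset.insert_erase (Finset.mem_filter.1 h).2]

/-- The sum of all principal minors of order `s`, as a real number. -/
noncomputable def minorSum (H : Matrix (Fin n) (Fin n) ℍ[ℝ]) (s : ℕ) : ℝ :=
  (sumPrincipalMinors s H).re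

/-- The sum, over the principal submatrices of order `s`, of their adjugate matrices. By
Faddeev-LeVerrier it satisfies the recursion used here as the definition. -/
noncomputable def adjugateSum (H : Matrix (Fin n) (Fin n) ℍ[ℝ]) :
    ℕ → Matrix (Fin n) (Fin n) ℍ[ℝ]
  | 0 => 0
  | s + 1 => minorSum H s • (1 : Matrix (Fin n) (Fin n) ℍ[ℝ]) - H * adjugateSum H s

variable {H : Matrix (Fin n) (Fin n) ℍ[ℝ]}

lemma coe_minorSum (hH : H.IsHermitian) (s : ℕ) :
    ((minorSum H s : ℝ) : ℍ[ℝ]) = sumPrincipalMinors s H := by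
  refine coe_re_of_star_eq ?_
  rw [sumPrincipalMinors_eq, star_sum]
  exact Finset.sum_congr rfl fun T _ => (isMinorFunction_minor H).star_eq hH T

lemma minorSum_zero (H : Matrix (Fin n) (Fin n) ℍ[ℝ]) : minorSum H 0 = 1 := by
  simp [minorSum, sumPrincipalMinors_eq, minor_empty]

lemma minorSum_of_lt (H : Matrix (Fin n) (Fin n) ℍ[ℝ]) {s : ℕ} (hs : n < s) :
    minorSum H s = 0 := by
  rw [minorSum, sumPrincipalMinors_eq, Finset.powersetCard_eq_empty.2 (by simpa using hs)]
  simp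

/-- The summands with `l ∈ V` vanish, so they may be included. -/
lemma sum_mul_disjConv_erase (hH : H.IsHermitian) (s : ℕ) (b : Fin n → ℍ[ℝ]) (j : Fin n) :
    ∑ T ∈ (Finset.univ : Finset (Fin n)).powersetCard (s + 1), ∑ l ∈ T,
        b l * disjConv (fun U => pathSum H U l j) (minor H) (T.erase l) =
      ∑ l, b l * ∑ V ∈ (Finset.univ : Finset (Fin n)).powersetCard s,
        disjConv (fun U => pathSum H U l j) (minor H) V := by
  rw [sum_powersetCard_sum_erase s
    fun l V => b l * disjConv (fun U => pathSum H U l j) (minor H) V]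
  refine Finset.sum_congr rfl fun l _ => ?_
  rw [Finset.mul_sum, Finset.sum_filter]
  refine Finset.sum_congr rfl fun V _ => ?_
  split_ifs with h
  · rw [(isMinorFunction_minor H).disjConv_eq_zero_of_mem_left hH j h, mul_zero]
  · rfl

/-- The expansions of all row determinants of order `s + 1` along the row `b`, written as a product
of `b` with a matrix. -/
lemma sum_expansion (hH : H.IsHermitian) (s : ℕ) (b : Fin n → ℍ[ℝ]) (j : Fin n) :
    ∑ T ∈ (Finset.univ : Finset (Fin n)).powersetCard s, (b j * minor H T - ∑ l ∈ T,
        b l * disjConv (fun U => pathSum H U l j) (minor H) (T.erase l)) =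
      ∑ l, b l * adjugateSum H (s + 1) l j := by
  have hone : ∀ (s : ℕ) (b : Fin n → ℍ[ℝ]) (j : Fin n),
      ∑ l, b l * (minorSum H s • (1 : Matrix (Fin n) (Fin n) ℍ[ℝ])) l j =
      ∑ T ∈ (Finset.univ : Finset (Fin n)).powersetCard s, b j * minor H T := by
    intro s b j
    rw [← Finset.mul_sum, ← sumPrincipalMinors_eq, ← coe_minorSum hH, Finset.sum_eq_single j]
    · rw [Matrix.smul_apply, Matrix.one_apply_eq, ← Quaternion.coe_mul_eq_smul, mul_one]
    · intro l _ hl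
      simp [Matrix.smul_apply, Matrix.one_apply_ne hl]
    · simp
  induction s generalizing b j with
  | zero => simpa [adjugateSum] using (hone 0 b j).symm
  | succ s ih =>
    rw [adjugateSum]
    simp only [Matrix.sub_apply, mul_sub, Finset.sum_sub_distrib, hone]
    rw [sum_mul_disjConv_erase hH]
    congr 1
    refine Finset.sum_congr rfl fun l _ => ?_
    rw [Matrix.mul_apply, ← ih]
    congr 1
    exact Finset.sum_congr rfl fun T _ => disjConv_pathSum H (minor H) l j T

/-- The product of `H` with the sum of the adjugates collects the path sums. -/
lemma mul_adjugateSum_apply (hH : H.IsHermitian) (s : ℕ) (i j : Fin n) :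
    (H * adjugateSum H (s + 1)) i j =
      ∑ T ∈ (Finset.univ : Finset (Fin n)).powersetCard s,
        disjConv (fun U => pathSum H U i j) (minor H) T := by
  rw [Matrix.mul_apply, ← sum_expansion hH]
  exact Finset.sum_congr rfl fun T _ => (disjConv_pathSum H (minor H) i j T).symm

/-- The sums of row determinants are the entries of a row times the sum of the adjugates. -/
lemma sumRdet_updateRow (hH : H.IsHermitian) (s : ℕ) (b : Fin n → ℍ[ℝ]) (j : Fin n) :
    sumRdet s j (H.updateRow j b) = ∑ l, b l * adjugateSum H s l j := by
  cases s with
  | zero =>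
    have : IsEmpty {α : Finset (Fin n) // α.card = 0 ∧ j ∈ α} := ⟨fun α => by
      have h := α.2.2
      rw [Finset.card_eq_zero.1 α.2.1] at h
      exact Finset.notMem_empty _ h⟩
    simp [sumRdet, adjugateSum]
  | succ s =>
    rw [sumRdet_eq, ← sum_expansion hH, Finset.sum_filter]
    refine Finset.sum_congr rfl fun T _ => ?_
    -- For `j ∈ T` only the summand `l = j` survives, and it cancels the first term.
    split_ifs with hj
    · rw [Finset.sum_eq_single_of_mem j hj, ← (isMinorFunction_minor H).expand_insert hH
        (Finset.notMem_erase j T), Finset.insert_erase hj, sub_self]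
      intro l _ hl
      rw [(isMinorFunction_minor H).disjConv_eq_zero_of_mem_right hH l
        (Finset.mem_erase.2 ⟨hl.symm, hj⟩), mul_zero]
    · rw [rowMinor_insert H hj]
      congr 1
      refine Finset.sum_congr rfl fun l _ => ?_
      rw [rowMinor_insert_row H fun h => hj (Finset.mem_of_mem_erase h)]

/-- Euler's relation: every principal minor of order `s` is counted once for each of its rows. -/
lemma trace_mul_adjugateSum (hH : H.IsHermitian) (s : ℕ) :
    ∑ j, (H * adjugateSum H s) j j = ((s * minorSum H s : ℝ) : ℍ[ℝ]) := by
  cases s with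
  | zero => simp [adjugateSum]
  | succ s =>
    have h : ∀ j, (H * adjugateSum H (s + 1)) j j =
        ∑ V ∈ (Finset.univ : Finset (Fin n)).powersetCard s with j ∉ V, minor H (insert j V) := by
      intro j
      rw [mul_adjugateSum_apply hH, Finset.sum_filter]
      refine Finset.sum_congr rfl fun V _ => ?_
      split_ifs with hj
      · rw [(isMinorFunction_minor H).disjConv_eq_zero_of_mem_left hH j hj]
      · rw [(isMinorFunction_minor H).expand_insert hH hj]
    rw [Finset.sum_congr rfl fun j _ => h j,
      ← sum_powersetCard_sum_erase s fun j V => minor H (insert j V), Quaternion.coe_mul,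
      coe_minorSum hH, sumPrincipalMinors_eq, Finset.mul_sum]
    refine Finset.sum_congr rfl fun T hT => ?_
    rw [Finset.sum_congr rfl fun l hl => by rw [Finset.insert_erase hl], Finset.sum_const,
      (Finset.mem_powersetCard.1 hT).2, nsmul_eq_mul, Quaternion.coe_natCast]

lemma adjugateSum_eq_zero (hH : H.IsHermitian) : adjugateSum H (n + 2) = 0 := by
  ext i j : 1
  rw [adjugateSum, minorSum_of_lt H (Nat.lt_succ_self n), zero_smul, zero_sub, Matrix.neg_apply,
    mul_adjugateSum_apply hH, Matrix.zero_apply, neg_eq_zero]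
  refine Finset.sum_eq_zero fun T hT => ?_
  have hT' : T = Finset.univ := by
    rw [← Finset.card_eq_iff_eq_univ, (Finset.mem_powersetCard.1 hT).2, Fintype.card_fin]
  exact (isMinorFunction_minor H).disjConv_eq_zero_of_mem_left hH j (hT' ▸ Finset.mem_univ i)

/-- Each sum of adjugates is a polynomial in `H` with real coefficients. -/
lemma commute_adjugateSum {A : Matrix (Fin n) (Fin n) ℍ[ℝ]} (hA : Commute A H) (s : ℕ) :
    Commute A (adjugateSum H s) := by
  induction s with
  | zero => exact Commute.zero_right A
  | succ s ih => exact ((Commute.one_right A).smul_right _).sub_right (hA.mul_right ih)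

lemma adjugateSum_add (H : Matrix (Fin n) (Fin n) ℍ[ℝ]) {s : ℕ} (hs : ∀ t, s < t → minorSum H t = 0)
    (p : ℕ) : adjugateSum H (s + 1 + p) = (-H) ^ p * adjugateSum H (s + 1) := by
  induction p with
  | zero => simp
  | succ p ih =>
    rw [← add_assoc, adjugateSum, hs _ (by omega), ih, pow_succ' (-H), mul_assoc]
    simp

end Adjugates

/-! ### Linear algebra over the quaternions -/

section LinearAlgebra

variable {n : ℕ}

lemma eq_zero_of_conjTranspose_mul_self {m n : ℕ} {Y : Matrix (Fin m) (Fin n) ℍ[ℝ]}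
    (h : Y.conjTranspose * Y = 0) : Y = 0 := by
  ext1 i j
  have hj : ((Y.conjTranspose * Y) j j).re = 0 := by
    rw [h]
    rfl
  rw [Matrix.mul_apply, re_sum] at hj
  simp only [Matrix.conjTranspose_apply, Quaternion.star_mul_self, Quaternion.re_coe] at hj
  rw [Finset.sum_eq_zero_iff_of_nonneg fun _ _ => Quaternion.normSq_nonneg] at hj
  exact Quaternion.normSq_eq_zero.1 (hj i (Finset.mem_univ i))

/-- A Hermitian matrix and its powers have the same kernel. -/
lemma mul_eq_zero_of_pow_mul_eq_zero {H Y : Matrix (Fin n) (Fin n) ℍ[ℝ]} (hH : H.IsHermitian)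
    (p : ℕ) (h : H ^ (p + 1) * Y = 0) : H * Y = 0 := by
  induction p with
  | zero => simpa using h
  | succ p ih =>
    refine ih (eq_zero_of_conjTranspose_mul_self ?_)
    rw [Matrix.conjTranspose_mul, (hH.pow (p + 1)).eq, mul_assoc, ← mul_assoc (H ^ (p + 1)),
      ← pow_add, show p + 1 + (p + 1) = p + (p + 1 + 1) by omega, pow_add, mul_assoc, h, mul_zero,
      mul_zero]

lemma exists_eq_mul_of_span_le {l m n : ℕ} {X : Matrix (Fin l) (Fin n) ℍ[ℝ]}
    {Y : Matrix (Fin m) (Fin n) ℍ[ℝ]}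
    (h : Submodule.span ℍ[ℝ] (Set.range X.row) ≤ Submodule.span ℍ[ℝ] (Set.range Y.row)) :
    ∃ Z : Matrix (Fin l) (Fin m) ℍ[ℝ], X = Z * Y := by
  have h' : ∀ i, ∃ c : Fin m → ℍ[ℝ], ∑ a, c a • Y.row a = X.row i := fun i =>
    (Submodule.mem_span_range_iff_exists_fun ℍ[ℝ]).1 (h (Submodule.subset_span ⟨i, rfl⟩))
  choose c hc using h'
  refine ⟨Matrix.of c, ?_⟩
  ext1 i j
  have := congrFun (hc i) j
  simp only [Matrix.row, Finset.sum_apply, Pi.smul_apply, smul_eq_mul] at this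
  rw [Matrix.mul_apply, ← this]
  rfl

lemma span_row_mul_le {l m n : ℕ} (Z : Matrix (Fin l) (Fin m) ℍ[ℝ])
    (Y : Matrix (Fin m) (Fin n) ℍ[ℝ]) :
    Submodule.span ℍ[ℝ] (Set.range (Z * Y).row) ≤ Submodule.span ℍ[ℝ] (Set.range Y.row) := by
  rw [Submodule.span_le]
  rintro _ ⟨i, rfl⟩
  refine (Submodule.mem_span_range_iff_exists_fun ℍ[ℝ]).2 ⟨Z i, ?_⟩
  ext1 j
  simp only [Matrix.row, Finset.sum_apply, Pi.smul_apply, smul_eq_mul, Matrix.mul_apply]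

/-- The real part of the trace of an idempotent is its rank, by a full rank factorization. -/
lemma re_trace_of_idempotent {P : Matrix (Fin n) (Fin n) ℍ[ℝ]} (hP : P * P = P) :
    ∑ i, (P i i).re = qrank P := by
  set W := Submodule.span ℍ[ℝ] (Set.range P.row)
  let b := Module.finBasis ℍ[ℝ] W
  let F : Matrix (Fin (qrank P)) (Fin n) ℍ[ℝ] := Matrix.of fun a => (b a : Fin n → ℍ[ℝ])
  have hli : LinearIndependent ℍ[ℝ] F.row :=
    b.linearIndependent.map' W.subtype (Submodule.ker_subtype W)
  have hspan : Submodule.span ℍ[ℝ] (Set.range F.row) = W := by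
    have h1 : Set.range F.row = W.subtype '' Set.range b := by
      rw [← Set.range_comp]
      rfl
    rw [h1, Submodule.span_image, b.span_eq, Submodule.map_top, Submodule.range_subtype]
  obtain ⟨C, hC⟩ := exists_eq_mul_of_span_le (X := P) (Y := F) (by rw [hspan])
  obtain ⟨G, hG⟩ := exists_eq_mul_of_span_le (X := F) (Y := P) (by rw [hspan])
  have hFP : F * P = F := by
    conv_lhs => rw [hG]
    rw [Matrix.mul_assoc, hP, ← hG]
  have hFC : F * C = 1 := by
    obtain ⟨D, hD⟩ : ∃ D : Matrix (Fin (qrank P)) (Fin (qrank P)) ℍ[ℝ], D = F * C - 1 := ⟨_, rfl⟩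
    have hDF : D * F = 0 := by
      rw [hD, Matrix.sub_mul, Matrix.one_mul, Matrix.mul_assoc, ← hC, hFP, sub_self]
    have hD0 : D = 0 := by
      ext1 a c
      refine Fintype.linearIndependent_iff.1 hli (D a) ?_ c
      ext1 j
      have : (D * F) a j = 0 := by
        rw [hDF]
        rfl
      rw [Matrix.mul_apply] at this
      simpa only [Matrix.row, Finset.sum_apply, Pi.smul_apply, smul_eq_mul, Pi.zero_apply]
        using this
    exact sub_eq_zero.1 (hD.symm.trans hD0)
  have h3 : ∑ i, (P i i).re = ∑ a, ((F * C) a a).re := by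
    conv_lhs => rw [hC]
    simp only [Matrix.mul_apply, re_sum]
    rw [Finset.sum_comm]
    exact Finset.sum_congr rfl fun a _ => Finset.sum_congr rfl fun i _ => re_mul_comm _ _
  rw [h3, hFC]
  simp

/-- Uniqueness of the Drazin inverse, in any monoid:
`x = x ^ (k + 1) a ^ (2 k + 1) y ^ (k + 1) = y`. -/
lemma eq_of_drazin_equations {M : Type*} [Monoid M] {a x y : M} {k : ℕ}
    (hx1 : a ^ (k + 1) * x = a ^ k) (hx2 : x * a * x = x) (hx3 : Commute a x)
    (hy1 : a ^ (k + 1) * y = a ^ k) (hy2 : y * a * y = y) (hy3 : Commute a y) : x = y := by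
  have key : ∀ {z : M}, a ^ (k + 1) * z = a ^ k → ∀ m, a ^ (k + m) * z ^ m = a ^ k := by
    intro z h1 m
    induction m with
    | zero => simp
    | succ m ih =>
      rw [show k + (m + 1) = m + (k + 1) by omega, pow_add, pow_succ' z, mul_assoc,
        ← mul_assoc (a ^ (k + 1)), h1, ← mul_assoc, ← pow_add, add_comm m k, ih]
  have key2 : ∀ {z : M}, z * a * z = z → Commute a z → ∀ m, z ^ (m + 1) * a ^ m = z := by
    intro z h2 h3 m
    induction m with
    | zero => simp
    | succ m ih =>
      calc z ^ (m + 1 + 1) * a ^ (m + 1) = z ^ m * (z * (z * a)) * a ^ m := by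
            rw [pow_succ, pow_succ, pow_succ' a]
            simp only [mul_assoc]
        _ = z ^ (m + 1) * a ^ m := by rw [← h3.eq, ← mul_assoc z, h2, ← pow_succ]
        _ = z := ih
  have hx : x = x ^ (k + 1) * a ^ k := (key2 hx2 hx3 k).symm
  have hy : a ^ k * y ^ (k + 1) = y := by
    rw [← (hy3.pow_pow k (k + 1)).symm.eq]
    exact key2 hy2 hy3 k
  rw [hx, ← key hy1 (k + 1), ← mul_assoc, (hx3.symm.pow_pow (k + 1) (k + (k + 1))).eq,
    key hx1, hy]

end LinearAlgebra

end QuaternionMatrix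

/-! ### The Drazin inverse of a Hermitian matrix -/

namespace QuaternionMatrix

section DrazinInverse

variable {n : ℕ}

/-- The last nonvanishing sum of principal minors of a Hermitian matrix `H` is that of order
`rank H`. If `s` is the last order, then `P = e_s⁻¹ H Q_s` is an idempotent with the row space of `H`,
where `Q_s` is the sum of adjugates; its trace is its rank, and it is `s` by Euler's relation. -/
lemma minorSum_qrank {H : Matrix (Fin n) (Fin n) ℍ[ℝ]} (hH : H.IsHermitian) :
    minorSum H (qrank H) ≠ 0 ∧ H * adjugateSum H (qrank H + 1) = 0 := by
  classical
  set s := Nat.findGreatest (fun t => minorSum H t ≠ 0) n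
  have hne : minorSum H s ≠ 0 := by
    refine Nat.findGreatest_spec (P := fun t => minorSum H t ≠ 0) (Nat.zero_le n) ?_
    rw [minorSum_zero]
    exact one_ne_zero
  have hgt : ∀ t, s < t → minorSum H t = 0 := by
    intro t ht
    by_cases htn : t ≤ n
    · exact not_not.1 (Nat.findGreatest_is_greatest ht htn)
    · exact minorSum_of_lt H (not_le.1 htn)
  have hsn : s ≤ n := Nat.findGreatest_le n
  have hker : H * adjugateSum H (s + 1) = 0 := by
    refine mul_eq_zero_of_pow_mul_eq_zero hH (n - s) ?_
    have h := adjugateSum_add H hgt (n - s + 1)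
    rw [show s + 1 + (n - s + 1) = n + 2 by omega, adjugateSum_eq_zero hH, neg_pow, mul_assoc] at h
    have h2 : (-1 : Matrix (Fin n) (Fin n) ℍ[ℝ]) ^ (n - s + 1) * (-1) ^ (n - s + 1) = 1 := by
      rw [← (Commute.refl _).mul_pow, neg_one_mul, neg_neg, one_pow]
    rw [← one_mul (H ^ (n - s + 1) * _), ← h2, mul_assoc, ← h, mul_zero]
  set Q := adjugateSum H s
  set P := (minorSum H s)⁻¹ • (H * Q) with hP
  have hcomm : Commute H Q := commute_adjugateSum (Commute.refl H) s
  have hHP : H * P = H := by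
    rw [adjugateSum, mul_sub, mul_smul_comm, mul_one, sub_eq_zero] at hker
    rw [hP, mul_smul_comm, ← hker, smul_smul, inv_mul_cancel₀ hne, one_smul]
  have hPH : P = (minorSum H s)⁻¹ • Q * H := by rw [hP, hcomm.eq, smul_mul_assoc]
  have hPP : P * P = P := by
    calc P * P = (minorSum H s)⁻¹ • Q * H * P := by rw [← hPH]
      _ = P := by rw [mul_assoc, hHP, ← hPH]
  have hrank : qrank P = qrank H := by
    have h1 : Submodule.span ℍ[ℝ] (Set.range P.row) = Submodule.span ℍ[ℝ] (Set.range H.row) := by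
      refine le_antisymm ?_ ?_
      · rw [hPH]
        exact span_row_mul_le _ _
      · conv_lhs => rw [← hHP]
        exact span_row_mul_le _ _
    rw [qrank, qrank, h1]
  have htr : (qrank P : ℝ) = s := by
    rw [← re_trace_of_idempotent hPP]
    have h1 : ∀ i, (P i i).re = (minorSum H s)⁻¹ * ((H * Q) i i).re := fun i => by
      rw [hP, Matrix.smul_apply, Quaternion.re_smul, smul_eq_mul]
    rw [Finset.sum_congr rfl fun i _ => h1 i, ← Finset.mul_sum, ← re_sum,
      trace_mul_adjugateSum hH, Quaternion.re_coe]
    field_simp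
  have hsr : qrank H = s := by
    rw [← hrank]
    exact_mod_cast htr
  rw [hsr]
  exact ⟨hne, hker⟩

/-- The Drazin inverse of a Hermitian matrix is `e_r⁻¹ A^k Q_r`, where `e_r` and `Q_r` are the sums
of the principal minors and of the adjugates of order `r = rank A^(k+1)` of `A^(k+1)`. -/
lemma isDrazinInverse_smul_adjugateSum {A : Matrix (Fin n) (Fin n) ℍ[ℝ]} (hA : A.IsHermitian)
    {r : ℕ} (hr : qrank (A ^ index A) = r) (hr' : qrank (A ^ (index A + 1)) = r) :
    IsDrazinInverse A ((minorSum (A ^ (index A + 1)) r)⁻¹ •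
      (A ^ index A * adjugateSum (A ^ (index A + 1)) r)) := by
  set k := index A
  set H := A ^ (k + 1) with hHdef
  have hH : H.IsHermitian := hA.pow (k + 1)
  obtain ⟨hne, hker⟩ := minorSum_qrank hH
  rw [hr'] at hne hker
  set e := minorSum H r
  set Q := adjugateSum H r
  have hAQ : Commute A Q := commute_adjugateSum (Commute.self_pow A (k + 1)) r
  have hspan : Submodule.span ℍ[ℝ] (Set.range (A ^ (k + 1)).row) =
      Submodule.span ℍ[ℝ] (Set.range (A ^ k).row) := by
    refine Submodule.eq_of_le_of_finrank_eq ?_ (hr'.trans hr.symm)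
    rw [pow_succ']
    exact span_row_mul_le _ _
  obtain ⟨Z, hZ⟩ := exists_eq_mul_of_span_le hspan.ge
  have hAk : A ^ k * (H * Q) = e • A ^ k := by
    have h : A ^ k * adjugateSum H (r + 1) = 0 := by
      rw [hZ, Matrix.mul_assoc, hker, Matrix.mul_zero]
    rw [adjugateSum, mul_sub, mul_smul_comm, mul_one, sub_eq_zero] at h
    exact h.symm
  have hHX : H * (A ^ k * Q) = e • A ^ k := by
    rw [← mul_assoc, (Commute.pow_pow_self A (k + 1) k).eq, mul_assoc, hAk]
  refine ⟨?_, ?_, ?_⟩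
  · rw [mul_smul_comm, hHX, smul_smul, inv_mul_cancel₀ hne, one_smul]
  · have h : A ^ k * Q * A * (A ^ k * Q) = e • (A ^ k * Q) := by
      calc A ^ k * Q * A * (A ^ k * Q) = A ^ k * (Q * H) * Q := by
            rw [hHdef, pow_succ']
            simp only [mul_assoc]
        _ = e • (A ^ k * Q) := by
            rw [← (commute_adjugateSum (Commute.refl H) r).eq, hAk, smul_mul_assoc]
    rw [smul_mul_assoc, smul_mul_assoc, mul_smul_comm, h, smul_smul e⁻¹ e, inv_mul_cancel₀ hne,
      one_smul]
  · rw [mul_smul_comm, smul_mul_assoc, ((Commute.self_pow A k).mul_right hAQ).eq]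

lemma IsDrazinInverse.eq {A X Y : Matrix (Fin n) (Fin n) ℍ[ℝ]} (hX : IsDrazinInverse A X)
    (hY : IsDrazinInverse A Y) : X = Y :=
  eq_of_drazin_equations hX.pow_mul hX.mul_mul hX.comm hY.pow_mul hY.mul_mul hY.comm

lemma IsDrazinInverse.drazinInverse_eq {A X : Matrix (Fin n) (Fin n) ℍ[ℝ]}
    (hX : IsDrazinInverse A X) : drazinInverse A = X := by
  have h : ∃ X, IsDrazinInverse A X := ⟨X, hX⟩
  rw [drazinInverse, dif_pos h]
  exact h.choose_spec.eq hX

end DrazinInverse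

end QuaternionMatrix

theorem theorem4p2 {m n : ℕ} (A : Matrix (Fin n) (Fin n) ℍ[ℝ]) (hA : A.IsHermitian)
    (B : Matrix (Fin m) (Fin n) ℍ[ℝ]) (k r : ℕ) (hk : QuaternionMatrix.index A = k)
    (hr : QuaternionMatrix.qrank (A ^ k) = r)
    (hr' : QuaternionMatrix.qrank (A ^ (k + 1)) = r) :
    (∃! X, QuaternionMatrix.IsDrazinInverse A X) ∧
    (∃ d : ℝ, d ≠ 0 ∧ QuaternionMatrix.sumPrincipalMinors r (A ^ (k + 1)) = (d : ℍ[ℝ])) ∧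
    ∀ (i : Fin m) (j : Fin n),
      (B * QuaternionMatrix.drazinInverse A) i j =
        QuaternionMatrix.sumRdet r j ((A ^ (k + 1)).updateRow j ((B * A ^ k).row i)) /
          QuaternionMatrix.sumPrincipalMinors r (A ^ (k + 1)) := by
  subst hk
  have hH : (A ^ (QuaternionMatrix.index A + 1)).IsHermitian := hA.pow _
  have hX := QuaternionMatrix.isDrazinInverse_smul_adjugateSum hA hr hr'
  have hne := (QuaternionMatrix.minorSum_qrank hH).1
  rw [hr'] at hne
  refine ⟨⟨_, hX, fun Y hY => hY.eq hX⟩, ⟨_, hne, (QuaternionMatrix.coe_minorSum hH r).symm⟩,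
    fun i j => ?_⟩
  rw [hX.drazinInverse_eq, QuaternionMatrix.sumRdet_updateRow hH,
    ← QuaternionMatrix.coe_minorSum hH r, Matrix.mul_smul, ← Matrix.mul_assoc, Matrix.smul_apply,
    div_eq_mul_inv, ← Quaternion.coe_inv, Quaternion.mul_coe_eq_smul, Matrix.mul_apply]
  rfl
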